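/- Let $\mathbb F_q$ be a finite field, $\ell\ge 1$, $r\ge1$, $\rho\ge2$, $k\ge 1$, and let $\alpha_1,\dots,\alpha_n\in\mathbb F_q$ be distinct points that are partitioned into repair groups of size $r+\rho-1$ on each of which a polynomial $g\in\mathbb F_q[x]$ of degree $r+\rho-1$ is constant, where $k/n\le r/(r+\rho-1)$. The Tamo--Barg code $\mathcal C$ consists of all vectors $(f(\alpha_1),\dots,f(\alpha_n))$ with $f=\sum_{m<k}u_m\,g^{\lfloor m/r\rfloor}x^{m \bmod r}$, $u\in\mathbb F_q^k$. Let $d$ be its minimum distance, and let $\mathcal{RS}$ be the Reed--Solomon code of dimension $n-d+1$ with the same evaluation points. The $\ell$-interleaved code of a code consists of the $\ell\times n$ matrices all of whose rows are codewords; the weight of an error matrix is its number of non-zero columns. Put $$t_{\max}=\frac{\ell}{\ell+1}(d-1).$$ The collaborative decoder of Schmidt, Sidorenko and Bossert for the $\ell$-interleaved code of $\mathcal{RS}$ computes the $d-1$ syndromes $S^{(i)}_m=\sum_j v_jR_{ij}\alpha_j^m$ $(0\le m\le d-2)$, $v_j=\prod_{i\ne j}(\alpha_j-\alpha_i)^{-1}$,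 of each row of the received matrix $R$ and a shortest linear feedback shift register that generates all $\ell$ syndrome sequences (any one of them, if there are several; the rule that selects it is a fixed function of the syndromes). If the length of this register is at most $t_{\max}$ and its monic characteristic polynomial $\Lambda$ has $\deg\Lambda$ distinct roots among the $\alpha_j$, these roots are taken as the error locations, the error values are computed from the syndromes, and $R$ minus the error is returned; otherwise a decoding failure is declared. For a transmitted codeword and an error matrix drawn uniformly at random from those of weight $t$, let $P_{\mathrm{failure}}$ and $P_{\mathrm{miscor.}}$ be the probabilities that this decoder declares a failure, respectively returns a codeword of the interleaved $\mathcal{RS}$ code other than the transmitted one. Decode the $\ell$-interleaved code of $\mathcal C$ with the same decoder, declaring a failure whenever the returned matrix is not in the $\ell$-interleaved code of $\mathcal C$. Then $\mathcal C\subseteq\mathcal{RS}$, both codes have minimum distance $d$, and for every integer $0\le t\le t_{\max}$, every transmitted codeword of the interleaved code of $\mathcal C$, and every transmitted codeword of the interleaved code of $\mathcal{RS}$ used to define $P_{\mathrm{failure}}$ and $P_{\mathrm{miscor.}}$ (so that these probabilities, and the success probability, do not depend on the codeword): 1. decoding of the interleaved Tamo--Barg code succeeds for exactly a fraction $1-P_{\mathrm{failure}}-P_{\mathrm{miscor.}}$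 of the error matrices of weight $t$; the sum of its failure and miscorrection probabilities is $P_{\mathrm{failure}}+P_{\mathrm{miscor.}}$, and its miscorrection probability is at most $P_{\mathrm{miscor.}}$; 2. $\displaystyle P_{\mathrm{failure}}+P_{\mathrm{miscor.}}\le\left(\frac{q^\ell-q^{-1}}{q^\ell-1}\right)^{t}\frac{q^{-(\ell+1)(t_{\max}-t)}}{q-1}$; 3. this success fraction is positive, and it equals $1$ if $2t<d$. -/

import Mathlib

open Polynomial

noncomputable section

namespace InterleavedLRC

/-! ### Codes -/

/-- `d` is the minimum (Hamming) distance of the linear code `C`. -/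
def IsMinDist {F : Type*} [Field F] {n : ℕ} (C : Submodule F (Fin n → F)) (d : ℕ) : Prop :=
  open Classical in
  IsLeast {w : ℕ | ∃ x ∈ C, ∃ y ∈ C, x ≠ y ∧ hammingDist x y = w} d

/-- The Reed-Solomon code of dimension parameter `K` with evaluation points `a`: all vectors
`(f (a 1), …, f (a n))` with `f` a polynomial of degree `< K`. -/
def rsCode {F : Type*} [Field F] {n : ℕ} (a : Fin n → F) (K : ℕ) : Submodule F (Fin n → F) :=
  (degreeLT F K).map (LinearMap.pi fun j => leval (a j))

/-- The Tamo-Barg encoding polynomial of the message `u`, that is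
`∑_{i < r} ∑_j u_{j r + i} g(x)^j x^i`, where the indices `m = j r + i` run over `m < k`. -/
def tamoBargPoly {F : Type*} [Field F] {k : ℕ} (r : ℕ) (g : F[X]) (u : Fin k → F) : F[X] :=
  ∑ m : Fin k, C (u m) * (X ^ ((m : ℕ) % r) * g ^ ((m : ℕ) / r))

/-- The Tamo-Barg code: evaluations at the points `a` of all encoding polynomials. -/
def tamoBargCode {F : Type*} [Field F] {n : ℕ} (k r : ℕ) (a : Fin n → F) (g : F[X]) :
    Submodule F (Fin n → F) where
  carrier := {c | ∃ u : Fin k → F, ∀ j, c j = (tamoBargPoly r g u).eval (a j)}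
  add_mem' := by
    rintro x y ⟨u, hu⟩ ⟨v, hv⟩
    refine ⟨u + v, fun j => ?_⟩
    simp [hu, hv, tamoBargPoly, eval_finsetSum, add_mul, Finset.sum_add_distrib]
  zero_mem' := ⟨0, fun j => by simp [tamoBargPoly]⟩
  smul_mem' := by
    rintro s x ⟨u, hu⟩
    refine ⟨s • u, fun j => ?_⟩
    simp [hu, tamoBargPoly, eval_finsetSum, Finset.mul_sum, mul_assoc]

/-- Admissible parameters of a Tamo-Barg code of length `n`, dimension `k` and `(r, ρ)`-locality:
the `n` evaluation points are distinct, and they are partitioned into repair groups of size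
`r + ρ - 1` on each of which the good polynomial `g`, of degree `r + ρ - 1`, is constant.  (As `g`
takes no value more than `r + ρ - 1` times, the repair groups are exactly the fibres of `g` on the
evaluation points.)  The last condition is the rate bound `k / n ≤ r / (r + ρ - 1)`. -/
structure IsTamoBarg {F : Type*} [Field F] (n k r ρ : ℕ) (a : Fin n → F) (g : F[X]) : Prop where
  one_le_k : 1 ≤ k
  one_le_r : 1 ≤ r
  two_le_rho : 2 ≤ ρ
  injective : Function.Injective a
  natDegree_eq : g.natDegree = r + ρ - 1
  card_group : ∀ i, {j | g.eval (a j) = g.eval (a i)}.ncard = r + ρ - 1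
  rate_le : k * (r + ρ - 1) ≤ n * r

/-- The `ℓ`-interleaved code: all matrices whose `ℓ` rows are codewords of `C`. -/
def interleaved {F : Type*} [Field F] {n : ℕ} (ℓ : ℕ) (C : Submodule F (Fin n → F)) :
    Set (Matrix (Fin ℓ) (Fin n) F) :=
  {M | ∀ i, M.row i ∈ C}

/-! ### Collaborative decoding of interleaved Reed-Solomon codes -/

/-- The maximal decoding radius `ℓ (d - 1) / (ℓ + 1)`. -/
def tMax (ℓ d : ℕ) : ℝ := (ℓ : ℝ) / (ℓ + 1) * ((d : ℝ) - 1)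

/-- The column multiplier `v_j = ∏_{i ≠ j} (a_j - a_i)⁻¹`; the matrix `(v_j a_j ^ m)`, `m < n - K`,
is a parity check matrix of `rsCode a K`. -/
def colMult {F : Type*} [Field F] {n : ℕ} (a : Fin n → F) (j : Fin n) : F :=
  ∏ i ∈ Finset.univ.erase j, (a j - a i)⁻¹

/-- The first `N` syndromes of each row of `R`. -/
def syndromes {F : Type*} [Field F] {ℓ n : ℕ} (a : Fin n → F) (N : ℕ)
    (R : Matrix (Fin ℓ) (Fin n) F) : Fin ℓ → Fin N → F :=
  fun i m => ∑ j, colMult a j * R i j * a j ^ (m : ℕ)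

/-- The linear feedback shift register of length `t = deg Λ` with monic characteristic polynomial
`Λ(x) = x ^ t σ(1 / x)` (where `σ`, with `σ(0) = 1` and `deg σ ≤ t`, is the connection polynomial)
generates all of the `ℓ` sequences `S i` of length `N`. -/
def IsRegister {F : Type*} [Field F] {ℓ N : ℕ} (S : Fin ℓ → Fin N → F) (Λ : F[X]) : Prop :=
  Λ.Monic ∧ ∀ (i : Fin ℓ) (m : ℕ) (hm : m + Λ.natDegree < N),
    ∑ j : Fin (Λ.natDegree + 1),
      Λ.coeff j * S i ⟨m + j, lt_of_le_of_lt (Nat.add_le_add_left (Fin.is_le j) m) hm⟩ = 0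

/-- `Λ` is a shortest shift register generating all the sequences `S i`. -/
def IsShortestRegister {F : Type*} [Field F] {ℓ N : ℕ} (S : Fin ℓ → Fin N → F) (Λ : F[X]) : Prop :=
  IsRegister S Λ ∧ ∀ Λ' : F[X], IsRegister S Λ' → Λ.natDegree ≤ Λ'.natDegree

/-- Every finite family of sequences has a shortest shift register. -/
theorem exists_isShortestRegister {F : Type*} [Field F] {ℓ N : ℕ} (S : Fin ℓ → Fin N → F) :
    ∃ Λ : F[X], IsShortestRegister S Λ := by
  classical
  have h : ∃ t : ℕ, ∃ Λ : F[X], IsRegister S Λ ∧ Λ.natDegree = t :=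
    ⟨N, X ^ N, ⟨monic_X_pow N, fun i m hm => absurd hm (by simp)⟩, by simp⟩
  obtain ⟨Λ, hΛ, hdeg⟩ := Nat.find_spec h
  exact ⟨Λ, hΛ, fun Λ' h' => hdeg ▸ Nat.find_min' h ⟨Λ', h', rfl⟩⟩

/-- The result of multi-sequence shift register synthesis, as a function of the `ℓ` sequences.
A shortest shift register need not be unique, and a synthesis algorithm returns one of them; a term
of this type is a rule that selects, for every input, one of the shortest registers. -/
abbrev RegisterSynthesis (F : Type*) [Field F] (ℓ N : ℕ) :=
  ∀ S : Fin ℓ → Fin N → F, {Λ : F[X] // IsShortestRegister S Λ}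

instance {F : Type*} [Field F] {ℓ N : ℕ} : Nonempty (RegisterSynthesis F ℓ N) :=
  ⟨fun S => ⟨(exists_isShortestRegister S).choose, (exists_isShortestRegister S).choose_spec⟩⟩

/-- The positions whose evaluation point is a root of the error locator polynomial `Λ`. -/
def errorLocations {F : Type*} [Field F] {n : ℕ} (a : Fin n → F) (Λ : F[X]) : Finset (Fin n) :=
  open Classical in
  Finset.univ.filter fun j => Λ.IsRoot (a j)

/-- Error evaluation: the matrix, zero outside the columns in `J`, obtained by solving
`∑_{j ∈ J} v_j e_{i j} a_j ^ m = S i m` for `m < |J|`; the Vandermonde matrix is inverted through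
the coefficients of the Lagrange basis polynomials of the points `a_j`, `j ∈ J`. -/
def errorValues {F : Type*} [Field F] {ℓ n N : ℕ} (a : Fin n → F) (J : Finset (Fin n))
    (S : Fin ℓ → Fin N → F) : Matrix (Fin ℓ) (Fin n) F :=
  Matrix.of fun i j =>
    if j ∈ J then (colMult a j)⁻¹ * ∑ m : Fin N, (Lagrange.basis J a j).coeff m * S i m else 0

/-- The collaborative decoder for the `ℓ`-interleaved Reed-Solomon code with evaluation points `a`
and minimum distance `d`: compute the `d - 1` syndromes of each row and a common shortest shift
register `Λ` of them.  If its length `t` is at most `tMax ℓ d` and `Λ` has exactly `t` distinct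
roots among the evaluation points, take these as the error locations, evaluate the errors and
subtract them from the received word.  Otherwise return `none` (a decoding failure). -/
def collaborativeDecoder {F : Type*} [Field F] {ℓ n : ℕ} (a : Fin n → F) (d : ℕ)
    (syn : RegisterSynthesis F ℓ (d - 1)) (R : Matrix (Fin ℓ) (Fin n) F) :
    Option (Matrix (Fin ℓ) (Fin n) F) :=
  open Classical in
  let S := syndromes a (d - 1) R
  let Λ : F[X] := (syn S).1
  let J := errorLocations a Λ
  if (Λ.natDegree : ℝ) ≤ tMax ℓ d ∧ J.card = Λ.natDegree then some (R - errorValues a J S)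
  else none

/-- Use a decoder `dec` of a supercode for the subcode `D`: an output of `dec` that is not in `D`
is replaced by a declared failure. -/
def subcodeDecoder {M : Type*} (D : Set M) (dec : M → Option M) (R : M) : Option M :=
  open Classical in
  (dec R).bind fun Y => if Y ∈ D then some Y else none

/-- The decoder of the `ℓ`-interleaved Tamo-Barg code of minimum distance `d`: the collaborative
decoder of the interleaved Reed-Solomon code of the same minimum distance, where an output that is
not a codeword of the interleaved Tamo-Barg code is replaced by a declared failure. -/
def tamoBargDecoder {F : Type*} [Field F] {n : ℕ} (ℓ k r : ℕ) (a : Fin n → F) (g : F[X]) (d : ℕ)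
    (syn : RegisterSynthesis F ℓ (d - 1)) :
    Matrix (Fin ℓ) (Fin n) F → Option (Matrix (Fin ℓ) (Fin n) F) :=
  subcodeDecoder (interleaved ℓ (tamoBargCode k r a g)) (collaborativeDecoder a d syn)

/-! ### Error model and outcome probabilities -/

/-- The set of indices of the non-zero columns of the error matrix `E`. -/
def errorSupport {F : Type*} [Field F] {ℓ n : ℕ} (E : Matrix (Fin ℓ) (Fin n) F) : Finset (Fin n) :=
  open Classical in
  Finset.univ.filter fun j => ∃ i, E i j ≠ 0

/-- The error matrices of weight `t`, i.e. with exactly `t` non-zero columns. -/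
def errorsOfWeight (F : Type*) [Field F] [Fintype F] (ℓ n t : ℕ) :
    Finset (Matrix (Fin ℓ) (Fin n) F) :=
  open Classical in
  Finset.univ.filter fun E => (errorSupport E).card = t

/-- The fraction of the error matrices of weight `t` that satisfy `p`, i.e. the probability of `p`
for an error matrix that is uniformly distributed over those of weight `t`. -/
def errorFraction {F : Type*} [Field F] [Fintype F] {ℓ n : ℕ} (t : ℕ)
    (p : Matrix (Fin ℓ) (Fin n) F → Prop) : ℝ :=
  open Classical in
  (((errorsOfWeight F ℓ n t).filter p).card : ℝ) / ((errorsOfWeight F ℓ n t).card : ℝ)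

/-- Probability of success: the decoder returns the transmitted codeword `Y`. -/
def successProb {F : Type*} [Field F] [Fintype F] {ℓ n : ℕ}
    (dec : Matrix (Fin ℓ) (Fin n) F → Option (Matrix (Fin ℓ) (Fin n) F))
    (Y : Matrix (Fin ℓ) (Fin n) F) (t : ℕ) : ℝ :=
  errorFraction t fun E => dec (Y + E) = some Y

/-- Probability of miscorrection: the decoder returns a codeword of the code `D` other than the
transmitted codeword `Y`. -/
def miscorrectionProb {F : Type*} [Field F] [Fintype F] {ℓ n : ℕ}
    (D : Set (Matrix (Fin ℓ) (Fin n) F))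
    (dec : Matrix (Fin ℓ) (Fin n) F → Option (Matrix (Fin ℓ) (Fin n) F))
    (Y : Matrix (Fin ℓ) (Fin n) F) (t : ℕ) : ℝ :=
  errorFraction t fun E => ∃ Z ∈ D, Z ≠ Y ∧ dec (Y + E) = some Z

/-- Probability of failure: the decoder returns no codeword. -/
def failureProb {F : Type*} [Field F] [Fintype F] {ℓ n : ℕ}
    (dec : Matrix (Fin ℓ) (Fin n) F → Option (Matrix (Fin ℓ) (Fin n) F))
    (Y : Matrix (Fin ℓ) (Fin n) F) (t : ℕ) : ℝ :=
  errorFraction t fun E => dec (Y + E) = none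

end InterleavedLRC

end

open InterleavedLRC

namespace InterleavedLRC

variable {F : Type*} [Field F] {n : ℕ}

/-! ### Generalized Vandermonde sums -/

theorem sum_mul_eval_eq_sum_coeff {ι : Type*} [Fintype ι] (z a : ι → F) {N : ℕ} {p : F[X]}
    (hp : p.degree < N) :
    ∑ j, z j * p.eval (a j) = ∑ m ∈ Finset.range N, p.coeff m * ∑ j, z j * a j ^ m := by
  have hp' : ∀ x, p.eval x = ∑ m ∈ Finset.range N, p.coeff m * x ^ m := fun x => by
    by_cases h0 : p = 0
    · simp [h0]
    · exact eval_eq_sum_range' ((natDegree_lt_iff_degree_lt h0).2 hp) x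
  simp_rw [hp', Finset.mul_sum]
  rw [Finset.sum_comm]
  exact Finset.sum_congr rfl fun _ _ => Finset.sum_congr rfl fun _ _ => by ring

/-- A linear functional vanishing on the powers `x ^ m`, `m < N`, vanishes on every polynomial of
degree `< N`. -/
theorem sum_mul_eval_eq_zero {ι : Type*} [Fintype ι] {z a : ι → F} {N : ℕ}
    (h : ∀ m < N, ∑ j, z j * a j ^ m = 0) {p : F[X]} (hp : p.degree < N) :
    ∑ j, z j * p.eval (a j) = 0 := by
  rw [sum_mul_eval_eq_sum_coeff z a hp]
  exact Finset.sum_eq_zero fun m hm => by rw [h m (Finset.mem_range.1 hm), mul_zero]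

/-- A vector supported on at most `N` positions whose first `N` power sums vanish is zero. -/
theorem eq_zero_of_sum_mul_pow_eq_zero {ι : Type*} [Fintype ι] {z a : ι → F}
    (ha : Function.Injective a) {N : ℕ} {W : Finset ι} (hW : W.card ≤ N)
    (hz : ∀ j ∉ W, z j = 0) (h : ∀ m < N, ∑ j, z j * a j ^ m = 0) : z = 0 := by
  classical
  funext j
  by_cases hj : j ∈ W
  · have hdeg : (Lagrange.basis W a j).degree < N := by
      rw [Lagrange.degree_basis ha.injOn hj]
      have := Finset.card_pos.2 ⟨j, hj⟩
      exact_mod_cast (by omega : W.card - 1 < N)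
    have := sum_mul_eval_eq_zero h hdeg
    rw [Finset.sum_eq_single j, Lagrange.eval_basis_self ha.injOn hj, mul_one] at this
    · exact this
    · intro i _ hij
      by_cases hi : i ∈ W
      · rw [Lagrange.eval_basis_of_ne hij.symm hi, mul_zero]
      · rw [hz i hi, zero_mul]
    · simp
  · exact hz j hj

/-! ### Parity checks of Reed-Solomon codes -/

theorem colMult_ne_zero {a : Fin n → F} (ha : Function.Injective a) (j : Fin n) :
    colMult a j ≠ 0 :=
  Finset.prod_ne_zero_iff.2 fun _ hi =>
    inv_ne_zero (sub_ne_zero.2 fun h => (Finset.mem_erase.1 hi).1 (ha h).symm)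

theorem sum_colMult_mul_eval {a : Fin n → F} (ha : Function.Injective a) {p : F[X]}
    (hp : p.degree < n) : ∑ j, colMult a j * p.eval (a j) = p.coeff (n - 1) := by
  have := Lagrange.coeff_eq_sum (s := Finset.univ) ha.injOn (P := p) (by simpa using hp)
  rw [Finset.card_univ, Fintype.card_fin] at this
  rw [this]
  refine Finset.sum_congr rfl fun j _ => ?_
  rw [colMult, Finset.prod_inv_distrib, div_eq_inv_mul]

theorem mem_rsCode {a : Fin n → F} {K : ℕ} {y : Fin n → F} :
    y ∈ rsCode a K ↔ ∃ f : F[X], f.degree < K ∧ ∀ j, y j = f.eval (a j) := by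
  constructor
  · rintro ⟨f, hf, rfl⟩
    exact ⟨f, mem_degreeLT.1 hf, fun j => by simp [leval]⟩
  · rintro ⟨f, hf, h⟩
    exact ⟨f, mem_degreeLT.2 hf, funext fun j => by simp [leval, h]⟩

theorem mem_rsCode_iff_parity {a : Fin n → F} (ha : Function.Injective a) {K : ℕ} (hK : K ≤ n)
    {y : Fin n → F} :
    y ∈ rsCode a K ↔ ∀ m < n - K, ∑ j, colMult a j * y j * a j ^ m = 0 := by
  rw [mem_rsCode]
  constructor
  · rintro ⟨f, hf, h⟩ m hm
    rcases eq_or_ne f 0 with rfl | hf0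
    · simp [h]
    have hfd := (natDegree_lt_iff_degree_lt hf0).2 hf
    have hnd : (f * X ^ m).natDegree = f.natDegree + m := natDegree_mul_X_pow m hf0
    have h2 := sum_colMult_mul_eval ha (p := f * X ^ m)
      ((natDegree_lt_iff_degree_lt (mul_ne_zero hf0 (pow_ne_zero _ X_ne_zero))).1
        (by rw [hnd]; omega))
    rw [coeff_eq_zero_of_natDegree_lt (by rw [hnd]; omega)] at h2
    rw [← h2]
    exact Finset.sum_congr rfl fun j _ => by simp [h, mul_assoc]
  · intro h
    set f := Lagrange.interpolate Finset.univ a y with hfdef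
    have hfn : f.degree < n := by
      have := Lagrange.degree_interpolate_lt (s := Finset.univ) y ha.injOn
      rwa [Finset.card_univ, Fintype.card_fin] at this
    have hfe : ∀ j, y j = f.eval (a j) := fun j =>
      (Lagrange.eval_interpolate_at_node y ha.injOn (Finset.mem_univ j)).symm
    refine ⟨f, ?_, hfe⟩
    by_contra hcon
    rcases eq_or_ne f 0 with hf0 | hf0
    · exact hcon (by rw [hf0, degree_zero]; exact WithBot.bot_lt_coe _)
    have hD : K ≤ f.natDegree := by
      by_contra hlt
      exact hcon ((natDegree_lt_iff_degree_lt hf0).1 (by omega))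
    have hDn := (natDegree_lt_iff_degree_lt hf0).2 hfn
    have hnd : (f * X ^ (n - 1 - f.natDegree)).natDegree = n - 1 := by
      rw [natDegree_mul_X_pow _ hf0]; omega
    have h2 := sum_colMult_mul_eval ha (p := f * X ^ (n - 1 - f.natDegree))
      ((natDegree_lt_iff_degree_lt (mul_ne_zero hf0 (pow_ne_zero _ X_ne_zero))).1
        (by rw [hnd]; omega))
    have h3 := h (n - 1 - f.natDegree) (by omega)
    have hlc : (f * X ^ (n - 1 - f.natDegree)).coeff (n - 1) = f.leadingCoeff := by
      rw [← leadingCoeff_mul_X_pow (n := n - 1 - f.natDegree), leadingCoeff, hnd]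
    rw [hlc] at h2
    refine hf0 (leadingCoeff_eq_zero.1 ?_)
    rw [← h2, ← h3]
    exact Finset.sum_congr rfl fun j _ => by simp [hfe, mul_assoc]

/-! ### Syndromes, registers and error values -/

theorem sum_coeff_mul_syndromes {ℓ N : ℕ} (a : Fin n → F) (R : Matrix (Fin ℓ) (Fin n) F)
    (i : Fin ℓ) {p : F[X]} (hp : p.degree < N) :
    ∑ m : Fin N, p.coeff m * syndromes a N R i m = ∑ j, colMult a j * R i j * p.eval (a j) := by
  rw [sum_mul_eval_eq_sum_coeff _ a hp, Finset.sum_range]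
  rfl

theorem isRegister_syndromes_iff {ℓ N : ℕ} {a : Fin n → F} {R : Matrix (Fin ℓ) (Fin n) F}
    {Λ : F[X]} :
    IsRegister (syndromes a N R) Λ ↔ Λ.Monic ∧ ∀ i m, m + Λ.natDegree < N →
      ∑ j, colMult a j * R i j * Λ.eval (a j) * a j ^ m = 0 := by
  have key : ∀ i (m : ℕ) (hm : m + Λ.natDegree < N),
      ∑ j : Fin (Λ.natDegree + 1), Λ.coeff j * syndromes a N R i
        ⟨m + j, lt_of_le_of_lt (Nat.add_le_add_left (Fin.is_le j) m) hm⟩ =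
      ∑ j, colMult a j * R i j * Λ.eval (a j) * a j ^ m := by
    intro i m hm
    simp only [syndromes, Finset.mul_sum]
    rw [Finset.sum_comm]
    refine Finset.sum_congr rfl fun j _ => ?_
    rw [eval_eq_sum_range, Finset.sum_range, Finset.mul_sum, Finset.sum_mul]
    exact Finset.sum_congr rfl fun k _ => by rw [pow_add]; ring
  constructor
  · exact fun h => ⟨h.1, fun i m hm => (key i m hm).symm.trans (h.2 i m hm)⟩
  · exact fun h => ⟨h.1, fun i m hm => (key i m hm).trans (h.2 i m hm)⟩

theorem mem_errorSupport {ℓ : ℕ} {E : Matrix (Fin ℓ) (Fin n) F} {j : Fin n} :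
    j ∈ errorSupport E ↔ ∃ i, E i j ≠ 0 := by
  simp [errorSupport]

theorem mem_errorLocations {a : Fin n → F} {Λ : F[X]} {j : Fin n} :
    j ∈ errorLocations a Λ ↔ Λ.eval (a j) = 0 := by
  simp only [errorLocations, Finset.mem_filter_univ, IsRoot.def]

theorem degree_basis_lt {a : Fin n → F} (ha : Function.Injective a) {J : Finset (Fin n)} {N : ℕ}
    (hJ : J.card ≤ N) {j : Fin n} (hj : j ∈ J) : (Lagrange.basis J a j).degree < N := by
  rw [Lagrange.degree_basis ha.injOn hj]
  have := Finset.card_pos.2 ⟨j, hj⟩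
  exact_mod_cast (by omega : J.card - 1 < N)

theorem colMult_mul_errorValues {ℓ N : ℕ} {a : Fin n → F} (ha : Function.Injective a)
    {J : Finset (Fin n)} (hJ : J.card ≤ N) (R : Matrix (Fin ℓ) (Fin n) F) (i : Fin ℓ) {j : Fin n}
    (hj : j ∈ J) :
    colMult a j * errorValues a J (syndromes a N R) i j =
      ∑ k, colMult a k * R i k * (Lagrange.basis J a j).eval (a k) := by
  rw [errorValues, Matrix.of_apply, if_pos hj, mul_inv_cancel_left₀ (colMult_ne_zero ha j),
    sum_coeff_mul_syndromes a R i (degree_basis_lt ha hJ hj)]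

/-- Error evaluation recovers an error matrix from its syndromes and its support. -/
theorem errorValues_syndromes {ℓ N : ℕ} {a : Fin n → F} (ha : Function.Injective a)
    {J : Finset (Fin n)} (hJ : J.card ≤ N) {E : Matrix (Fin ℓ) (Fin n) F}
    (hE : errorSupport E ⊆ J) : errorValues a J (syndromes a N E) = E := by
  have hE0 : ∀ i, ∀ j ∉ J, E i j = 0 := fun i j hj => by
    by_contra h
    exact hj (hE (mem_errorSupport.2 ⟨i, h⟩))
  ext i j
  by_cases hj : j ∈ J
  · refine mul_left_cancel₀ (colMult_ne_zero ha j) ?_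
    rw [colMult_mul_errorValues ha hJ E i hj, Finset.sum_eq_single j,
      Lagrange.eval_basis_self ha.injOn hj, mul_one]
    · intro k _ hkj
      by_cases hk : k ∈ J
      · rw [Lagrange.eval_basis_of_ne hkj.symm hk, mul_zero]
      · rw [hE0 i k hk, mul_zero, zero_mul]
    · simp
  · rw [errorValues, Matrix.of_apply, if_neg hj, hE0 i j hj]

/-- If a register splits into distinct factors at evaluation points, then error evaluation yields a
matrix with the given syndromes. -/
theorem syndromes_errorValues {ℓ N : ℕ} {a : Fin n → F} (ha : Function.Injective a)
    {R : Matrix (Fin ℓ) (Fin n) F} {Λ : F[X]} (hΛ : IsRegister (syndromes a N R) Λ)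
    (hN : Λ.natDegree ≤ N) (hcard : (errorLocations a Λ).card = Λ.natDegree) :
    syndromes a N (errorValues a (errorLocations a Λ) (syndromes a N R)) = syndromes a N R := by
  set J := errorLocations a Λ with hJ
  rw [isRegister_syndromes_iff] at hΛ
  obtain ⟨hmon, hreg⟩ := hΛ
  have hJN : J.card ≤ N := hcard.trans_le hN
  ext i ⟨m, hm⟩
  have hr : (X ^ m : F[X]) %ₘ Λ = Lagrange.interpolate J a fun j => a j ^ m := by
    refine Lagrange.eq_interpolate_of_eval_eq _ ha.injOn ?_ fun j hj => ?_
    · rw [hcard, ← degree_eq_natDegree hmon.ne_zero]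
      exact degree_modByMonic_lt _ hmon
    · have h0 := mem_errorLocations.1 hj
      have := congrArg (eval (a j)) (modByMonic_add_div (X ^ m : F[X]) Λ)
      simpa [h0] using this
  have hquot : ∑ j, colMult a j * R i j * Λ.eval (a j) * ((X ^ m : F[X]) /ₘ Λ).eval (a j) = 0 := by
    by_cases hlt : m < Λ.natDegree
    · have : (X ^ m : F[X]) /ₘ Λ = 0 := by
        rw [divByMonic_eq_zero_iff hmon, degree_X_pow, degree_eq_natDegree hmon.ne_zero]
        exact_mod_cast hlt
      simp [this]
    · refine sum_mul_eval_eq_zero (N := N - Λ.natDegree) (fun k hk => hreg i k (by omega)) ?_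
      refine lt_of_le_of_lt degree_le_natDegree ?_
      rw [natDegree_divByMonic _ hmon, natDegree_X_pow]
      exact_mod_cast (by omega : m - Λ.natDegree < N - Λ.natDegree)
  have h1 : syndromes a N R i ⟨m, hm⟩ =
      ∑ j, colMult a j * R i j * ((X ^ m : F[X]) %ₘ Λ).eval (a j) := by
    have : ∀ j, a j ^ m = ((X ^ m : F[X]) %ₘ Λ).eval (a j)
        + Λ.eval (a j) * ((X ^ m : F[X]) /ₘ Λ).eval (a j) := fun j => by
      rw [← eval_mul, ← eval_add, modByMonic_add_div, eval_pow, eval_X]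
    calc syndromes a N R i ⟨m, hm⟩ = ∑ j, colMult a j * R i j * a j ^ m := rfl
      _ = ∑ j, (colMult a j * R i j * ((X ^ m : F[X]) %ₘ Λ).eval (a j)
          + colMult a j * R i j * Λ.eval (a j) * ((X ^ m : F[X]) /ₘ Λ).eval (a j)) :=
        Finset.sum_congr rfl fun j _ => by rw [this j]; ring
      _ = _ := by rw [Finset.sum_add_distrib, hquot, add_zero]
  rw [h1, hr, Lagrange.interpolate_apply]
  simp only [eval_finsetSum, eval_mul, eval_C, Finset.mul_sum]
  rw [Finset.sum_comm]
  calc ∑ j, colMult a j * errorValues a J (syndromes a N R) i j * a j ^ m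
      = ∑ j ∈ J, colMult a j * errorValues a J (syndromes a N R) i j * a j ^ m := by
        refine (Finset.sum_subset (Finset.subset_univ J) fun j _ hj => ?_).symm
        simp [errorValues, hj]
    _ = _ := Finset.sum_congr rfl fun j hj => by
        rw [colMult_mul_errorValues ha hJN R i hj, Finset.sum_mul]
        exact Finset.sum_congr rfl fun k _ => by ring

end InterleavedLRC

namespace InterleavedLRC

variable {F : Type*} [Field F] {n : ℕ}

/-! ### The collaborative decoder -/

theorem le_tMax_iff {ℓ d t : ℕ} (hd : 1 ≤ d) :
    (t : ℝ) ≤ tMax ℓ d ↔ (ℓ + 1) * t ≤ ℓ * (d - 1) := by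
  obtain ⟨N, rfl⟩ : ∃ N, d = N + 1 := ⟨d - 1, by omega⟩
  have h : (0 : ℝ) < ℓ + 1 := by positivity
  rw [tMax, div_mul_eq_mul_div, le_div_iff₀ h, Nat.add_sub_cancel, ← Nat.cast_le (α := ℝ)]
  push_cast
  rw [add_sub_cancel_right, mul_comm]

theorem le_of_mul_le {ℓ N t : ℕ} (h : (ℓ + 1) * t ≤ ℓ * N) : t ≤ N :=
  le_of_mul_le_mul_left (h.trans (Nat.mul_le_mul_right N ℓ.le_succ)) ℓ.succ_pos

theorem mem_interleaved_rsCode_iff {ℓ d : ℕ} {a : Fin n → F} (ha : Function.Injective a)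
    (hd : 1 ≤ d) (hdn : d ≤ n) {M : Matrix (Fin ℓ) (Fin n) F} :
    M ∈ interleaved ℓ (rsCode a (n + 1 - d)) ↔ syndromes a (d - 1) M = 0 := by
  have : n - (n + 1 - d) = d - 1 := by omega
  simp only [interleaved, Set.mem_ofPred_eq, mem_rsCode_iff_parity ha (by omega : n + 1 - d ≤ n),
    this]
  constructor
  · intro h
    ext i m
    exact h i m m.2
  · intro h i m hm
    exact congrFun (congrFun h i) ⟨m, hm⟩

theorem syndromes_add {ℓ N : ℕ} (a : Fin n → F) (M M' : Matrix (Fin ℓ) (Fin n) F) :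
    syndromes a N (M + M') = syndromes a N M + syndromes a N M' := by
  ext i m
  simp [syndromes, mul_add, add_mul, Finset.sum_add_distrib]

theorem syndromes_sub {ℓ N : ℕ} (a : Fin n → F) (M M' : Matrix (Fin ℓ) (Fin n) F) :
    syndromes a N (M - M') = syndromes a N M - syndromes a N M' := by
  ext i m
  simp [syndromes, mul_sub, sub_mul, Finset.sum_sub_distrib]

/-- The decoder commutes with translations by codewords. -/
theorem collaborativeDecoder_add {ℓ d : ℕ} {a : Fin n → F} (ha : Function.Injective a)
    (hd : 1 ≤ d) (hdn : d ≤ n) (syn : RegisterSynthesis F ℓ (d - 1))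
    {Y : Matrix (Fin ℓ) (Fin n) F} (hY : Y ∈ interleaved ℓ (rsCode a (n + 1 - d)))
    (E : Matrix (Fin ℓ) (Fin n) F) :
    collaborativeDecoder a d syn (Y + E) = (collaborativeDecoder a d syn E).map (Y + ·) := by
  have hS : syndromes a (d - 1) (Y + E) = syndromes a (d - 1) E := by
    rw [syndromes_add, (mem_interleaved_rsCode_iff ha hd hdn).1 hY, zero_add]
  simp only [collaborativeDecoder]
  rw [hS]
  split_ifs
  · simp [add_sub_assoc]
  · rfl

/-- The decoder only returns codewords. -/
theorem mem_of_collaborativeDecoder_eq_some {ℓ d : ℕ} {a : Fin n → F}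
    (ha : Function.Injective a) (hd : 1 ≤ d) (hdn : d ≤ n) {syn : RegisterSynthesis F ℓ (d - 1)}
    {R Z : Matrix (Fin ℓ) (Fin n) F} (h : collaborativeDecoder a d syn R = some Z) :
    Z ∈ interleaved ℓ (rsCode a (n + 1 - d)) := by
  rw [mem_interleaved_rsCode_iff ha hd hdn]
  simp only [collaborativeDecoder] at h
  split_ifs at h with hc
  rw [← Option.some.inj h, syndromes_sub, syndromes_errorValues ha (syn _).2.1
    (le_of_mul_le ((le_tMax_iff hd).1 hc.1)) hc.2, sub_self]

theorem card_errorLocations_le {a : Fin n → F} (ha : Function.Injective a) {Λ : F[X]}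
    (hΛ : Λ ≠ 0) : (errorLocations a Λ).card ≤ Λ.natDegree := by
  classical
  rw [← Finset.card_image_of_injective _ ha]
  refine (Finset.card_le_card fun x hx => ?_).trans
    ((Multiset.toFinset_card_le Λ.roots).trans (card_roots' _))
  obtain ⟨j, hj, rfl⟩ := Finset.mem_image.1 hx
  rw [Multiset.mem_toFinset, mem_roots hΛ]
  exact mem_errorLocations.1 hj

/-- The coefficient vectors `c` for which scaling the columns of `E` by `c` yields a matrix with
`δ` vanishing syndromes. -/
def IsAnnihilator {ℓ : ℕ} (a : Fin n → F) (δ : ℕ) (E : Matrix (Fin ℓ) (Fin n) F)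
    (c : Fin n → F) : Prop :=
  ∀ i, ∀ m < δ, ∑ j, colMult a j * E i j * c j * a j ^ m = 0

/-- The decoder succeeds if no vector that is non-zero on the support of `E` annihilates `E`. -/
theorem collaborativeDecoder_eq_some_zero {ℓ d t : ℕ} {a : Fin n → F}
    (ha : Function.Injective a) (hd : 1 ≤ d) (syn : RegisterSynthesis F ℓ (d - 1))
    {E : Matrix (Fin ℓ) (Fin n) F} (hE : (errorSupport E).card = t) (ht : (t : ℝ) ≤ tMax ℓ d)
    (h : ∀ c, IsAnnihilator a (d - 1 - t) E c → ∀ j ∈ errorSupport E, c j = 0) :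
    collaborativeDecoder a d syn E = some 0 := by
  set J := errorSupport E with hJ
  set S := syndromes a (d - 1) E with hS
  have hE0 : ∀ i, ∀ j ∉ J, E i j = 0 := fun i j hj => by
    by_contra h
    exact hj (mem_errorSupport.2 ⟨i, h⟩)
  have htN : t ≤ d - 1 := le_of_mul_le ((le_tMax_iff hd).1 ht)
  have hreg : IsRegister S (Lagrange.nodal J a) := by
    refine isRegister_syndromes_iff.2 ⟨Lagrange.nodal_monic, fun i m _ => ?_⟩
    refine Finset.sum_eq_zero fun j _ => ?_
    by_cases hj : j ∈ J
    · rw [Lagrange.eval_nodal_at_node hj]; ring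
    · rw [hE0 i j hj]; ring
  have hle : (syn S).1.natDegree ≤ t := by
    have := (syn S).2.2 _ hreg
    rwa [Lagrange.natDegree_nodal, hE] at this
  obtain ⟨hmon, hsyn⟩ := isRegister_syndromes_iff.1 (syn S).2.1
  have hroot := h (fun j => (syn S).1.eval (a j)) fun i m hm => hsyn i m (by omega)
  have hsub : J ⊆ errorLocations a (syn S).1 := fun j hj => mem_errorLocations.2 (hroot j hj)
  have hcard : (errorLocations a (syn S).1).card ≤ (syn S).1.natDegree :=
    card_errorLocations_le ha hmon.ne_zero
  have hJcard := Finset.card_le_card hsub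
  have heq : (syn S).1.natDegree = t := by omega
  have hcond : ((syn S).1.natDegree : ℝ) ≤ tMax ℓ d ∧
      (errorLocations a (syn S).1).card = (syn S).1.natDegree :=
    ⟨by rw [heq]; exact ht, by omega⟩
  simp only [collaborativeDecoder]
  rw [if_pos hcond, errorValues_syndromes ha (by omega) hsub, sub_self]

end InterleavedLRC

namespace InterleavedLRC

variable {F : Type*} [Field F] {n : ℕ}

/-! ### Counting error matrices that have an annihilator -/

theorem eq_zero_of_notMem_errorSupport {ℓ : ℕ} {E : Matrix (Fin ℓ) (Fin n) F} {j : Fin n}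
    (hj : j ∉ errorSupport E) (i : Fin ℓ) : E i j = 0 := by
  by_contra h
  exact hj (mem_errorSupport.2 ⟨i, h⟩)

theorem IsAnnihilator.mul_eq_zero {ℓ δ : ℕ} {a : Fin n → F} (ha : Function.Injective a)
    {E : Matrix (Fin ℓ) (Fin n) F} {c : Fin n → F} (h : IsAnnihilator a δ E c) {i : Fin ℓ}
    {W : Finset (Fin n)} (hW : W.card ≤ δ) (hz : ∀ j ∉ W, E i j * c j = 0) (j : Fin n) :
    E i j * c j = 0 := by
  have := congrFun (eq_zero_of_sum_mul_pow_eq_zero (z := fun j => colMult a j * E i j * c j) ha hW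
    (fun j hj => by rw [mul_assoc, hz j hj, mul_zero]) (h i)) j
  simpa [mul_assoc, colMult_ne_zero ha j] using this

/-- If the number of errors is at most the number `δ` of syndromes, annihilators vanish on the
support of the error matrix. -/
theorem IsAnnihilator.eq_zero_of_card_le {ℓ δ : ℕ} {a : Fin n → F} (ha : Function.Injective a)
    {E : Matrix (Fin ℓ) (Fin n) F} {c : Fin n → F} (h : IsAnnihilator a δ E c)
    (hE : (errorSupport E).card ≤ δ) {j : Fin n} (hj : j ∈ errorSupport E) : c j = 0 := by
  obtain ⟨i, hi⟩ := mem_errorSupport.1 hj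
  refine (_root_.mul_eq_zero.1
    (h.mul_eq_zero ha hE (i := i) (fun k hk => ?_) j)).resolve_left hi
  rw [eq_zero_of_notMem_errorSupport hk, zero_mul]

theorem IsAnnihilator.smul {ℓ δ : ℕ} {a : Fin n → F} {E : Matrix (Fin ℓ) (Fin n) F}
    {c : Fin n → F} (h : IsAnnihilator a δ E c) (x : F) : IsAnnihilator a δ E (x • c) := by
  intro i m hm
  have := congrArg (x * ·) (h i m hm)
  simp only [Finset.mul_sum, mul_zero] at this
  rw [← this]
  exact Finset.sum_congr rfl fun j _ => by simp only [Pi.smul_apply, smul_eq_mul]; ring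

variable [Fintype F]

open Classical in
/-- The number of error matrices with support `J` that are annihilated by a fixed non-zero vector
supported on `J`. -/
theorem card_annihilated_mul_le {ℓ δ : ℕ} {a : Fin n → F} (ha : Function.Injective a)
    (J : Finset (Fin n)) {c : Fin n → F} (hc : c ≠ 0) (hcJ : ∀ j ∉ J, c j = 0) :
    (Finset.univ.filter fun E : Matrix (Fin ℓ) (Fin n) F =>
        errorSupport E = J ∧ IsAnnihilator a δ E c).card * (Fintype.card F ^ ℓ) ^ δ ≤
      ∏ j, if j ∈ J then (if c j = 0 then Fintype.card F ^ ℓ - 1 else Fintype.card F ^ ℓ)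
        else 1 := by
  set T := Finset.univ.filter fun E : Matrix (Fin ℓ) (Fin n) F =>
        errorSupport E = J ∧ IsAnnihilator a δ E c with hT
  set W := Finset.univ.filter fun j => c j ≠ 0 with hW
  have hWJ : ∀ j ∈ W, j ∈ J := fun j hj => by
    by_contra h
    exact (Finset.mem_filter.1 hj).2 (hcJ j h)
  have hcW : ∀ j ∉ W, c j = 0 := fun j hj => by simpa [hW] using hj
  rcases lt_or_ge W.card δ with hlt | hge
  · have : T = ∅ := by
      refine Finset.eq_empty_of_forall_notMem fun E hE => ?_
      obtain ⟨-, hEJ, hEc⟩ := Finset.mem_filter.1 hE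
      obtain ⟨j, hj⟩ := Function.ne_iff.1 hc
      have hjJ : j ∈ J := hWJ j (by simpa [hW] using hj)
      rw [← hEJ] at hjJ
      obtain ⟨i, hi⟩ := mem_errorSupport.1 hjJ
      refine mul_ne_zero hi hj (hEc.mul_eq_zero ha hlt.le (i := i) (fun k hk => ?_) j)
      rw [hcW k hk, mul_zero]
    simp [this]
  · obtain ⟨W₀, hW₀, hcard⟩ := Finset.exists_subset_card_eq hge
    set Ys : Finset (Fin n → Fin ℓ → F) :=
      Fintype.piFinset fun j => if j ∈ W₀ then Finset.univ else {0} with hYs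
    set B : Fin n → Finset (Fin ℓ → F) := fun j =>
      if j ∈ J then (if c j = 0 then Finset.univ.erase 0 else Finset.univ) else {0} with hB
    have hYcard : Ys.card = (Fintype.card F ^ ℓ) ^ δ := by
      rw [hYs, Fintype.card_piFinset]
      simp only [apply_ite Finset.card, Finset.card_univ, Finset.card_singleton]
      rw [Finset.prod_ite_mem, Finset.univ_inter, Finset.prod_const, hcard]
      simp
    have hBcard : (Fintype.piFinset B).card =
        ∏ j, if j ∈ J then (if c j = 0 then Fintype.card F ^ ℓ - 1 else Fintype.card F ^ ℓ)
          else 1 := by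
      rw [Fintype.card_piFinset]
      refine Finset.prod_congr rfl fun j _ => ?_
      simp only [hB]
      split_ifs <;> simp
    have hYs0 : ∀ y ∈ Ys, ∀ j ∉ W₀, y j = 0 := fun y hy j hj => by
      have := Fintype.mem_piFinset.1 hy j
      simpa [hj] using this
    rw [← hYcard, ← Finset.card_product, ← hBcard]
    refine Finset.card_le_card_of_injOn (fun p j i => p.1 i j + p.2 j i) ?_ ?_
    · rintro ⟨E, y⟩ hp
      obtain ⟨hE, hy⟩ := Finset.mem_product.1 hp
      obtain ⟨-, hEJ, -⟩ := Finset.mem_filter.1 hE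
      refine Fintype.mem_piFinset.2 fun j => ?_
      simp only [hB]
      split_ifs with hj hcj
      · have hjW : j ∉ W₀ := fun h => (Finset.mem_filter.1 (hW₀ h)).2 hcj
        rw [← hEJ] at hj
        obtain ⟨i, hi⟩ := mem_errorSupport.1 hj
        refine Finset.mem_erase.2 ⟨fun h => hi ?_, Finset.mem_univ _⟩
        simpa [hYs0 y hy j hjW] using congrFun h i
      · exact Finset.mem_univ _
      · have hjW : j ∉ W₀ := fun h => hj (hWJ j (hW₀ h))
        rw [← hEJ] at hj
        simp only [Finset.mem_singleton]
        funext i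
        simpa [hYs0 y hy j hjW] using eq_zero_of_notMem_errorSupport hj i
    · rintro ⟨E, y⟩ hp ⟨E', y'⟩ hp' heq
      obtain ⟨hE, hy⟩ := Finset.mem_product.1 hp
      obtain ⟨hE', hy'⟩ := Finset.mem_product.1 hp'
      obtain ⟨-, hEJ, hEc⟩ := Finset.mem_filter.1 hE
      obtain ⟨-, hEJ', hEc'⟩ := Finset.mem_filter.1 hE'
      have hsum : ∀ i j, E i j + y j i = E' i j + y' j i := fun i j =>
        congrFun (congrFun heq j) i
      have hann : IsAnnihilator a δ (E - E') c := fun i m hm => by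
        have := congrArg₂ (· - ·) (hEc i m hm) (hEc' i m hm)
        simp only [← Finset.sum_sub_distrib, sub_zero] at this
        rw [← this]
        exact Finset.sum_congr rfl fun j _ => by rw [Matrix.sub_apply]; ring
      have hout : ∀ i, ∀ j ∉ W₀, E i j = E' i j := fun i j hj => by
        simpa [hYs0 y hy j hj, hYs0 y' hy' j hj] using hsum i j
      have hEE : E = E' := by
        ext i j
        by_cases hj : j ∈ W₀
        · have := hann.mul_eq_zero ha hcard.le (i := i)
            (fun k hk => by rw [Matrix.sub_apply, hout i k hk, sub_self, zero_mul]) j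
          have hcj : c j ≠ 0 := (Finset.mem_filter.1 (hW₀ hj)).2
          exact sub_eq_zero.1 ((mul_eq_zero.1 this).resolve_right hcj)
        · exact hout i j hj
      subst hEE
      have : y = y' := by
        funext j i
        exact add_left_cancel (hsum i j)
      rw [this]

open Classical in
/-- Summing the bound of `card_annihilated_mul_le` over all vectors supported on `J`. -/
theorem sum_prod_ite_eq (J : Finset (Fin n)) {Q : ℕ} (hQ : 1 ≤ Q) :
    ∑ c ∈ Fintype.piFinset fun j => if j ∈ J then (Finset.univ : Finset F) else {0},
      ∏ j, (if j ∈ J then (if c j = 0 then Q - 1 else Q) else 1) =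
    (Fintype.card F * Q - 1) ^ J.card := by
  rw [← Finset.prod_univ_sum (fun j => if j ∈ J then (Finset.univ : Finset F) else {0})
    fun j x => if j ∈ J then (if x = 0 then Q - 1 else Q) else 1]
  have hq : 1 ≤ Fintype.card F := Fintype.card_pos
  have h : ∑ x : F, (if x = 0 then Q - 1 else Q) = Fintype.card F * Q - 1 := by
    rw [← Finset.add_sum_erase _ _ (Finset.mem_univ (0 : F)), if_pos rfl,
      Finset.sum_congr rfl fun x hx => if_neg (Finset.ne_of_mem_erase hx), Finset.sum_const,
      Finset.card_erase_of_mem (Finset.mem_univ _), Finset.card_univ, smul_eq_mul]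
    obtain ⟨q, hq'⟩ : ∃ q, Fintype.card F = q + 1 := ⟨Fintype.card F - 1, by omega⟩
    rw [hq', Nat.add_sub_cancel, add_mul, one_mul]
    omega
  have : ∀ j, (∑ x ∈ (if j ∈ J then (Finset.univ : Finset F) else {0}),
      if j ∈ J then (if x = 0 then Q - 1 else Q) else 1) =
      if j ∈ J then Fintype.card F * Q - 1 else 1 := fun j => by
    by_cases hj : j ∈ J
    · simp only [hj, if_true, h]
    · simp [hj]
  rw [Finset.prod_congr rfl fun j _ => this j, Finset.prod_ite_mem, Finset.univ_inter,
    Finset.prod_const]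

open Classical in
/-- The number of error matrices with support `J` that have a non-trivial annihilator. -/
theorem card_exists_annihilator_mul_le {ℓ δ : ℕ} {a : Fin n → F} (ha : Function.Injective a)
    (J : Finset (Fin n)) :
    (Finset.univ.filter fun E : Matrix (Fin ℓ) (Fin n) F =>
        errorSupport E = J ∧ ∃ c, IsAnnihilator a δ E c ∧ ∃ j ∈ J, c j ≠ 0).card *
          ((Fintype.card F - 1) * (Fintype.card F ^ ℓ) ^ δ) ≤
      (Fintype.card F * Fintype.card F ^ ℓ - 1) ^ J.card := by
  set bad := Finset.univ.filter fun E : Matrix (Fin ℓ) (Fin n) F =>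
    errorSupport E = J ∧ ∃ c, IsAnnihilator a δ E c ∧ ∃ j ∈ J, c j ≠ 0 with hbad
  set Cs : Finset (Fin n → F) :=
    Fintype.piFinset fun j => if j ∈ J then (Finset.univ : Finset F) else {0} with hCs
  have hmemC : ∀ c, c ∈ Cs ↔ ∀ j ∉ J, c j = 0 := fun c => by
    rw [hCs, Fintype.mem_piFinset]
    refine forall_congr' fun j => ?_
    by_cases hj : j ∈ J <;> simp [hj]
  have hlow : ∀ E ∈ bad, Fintype.card F - 1 ≤
      (Finset.bipartiteAbove (IsAnnihilator a δ) (Cs.erase 0) E).card := by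
    intro E hE
    obtain ⟨-, hEJ, c, hc, j, hj, hcj⟩ := Finset.mem_filter.1 hE
    set c' : Fin n → F := fun j => if j ∈ J then c j else 0 with hc'
    have hc'a : IsAnnihilator a δ E c' := fun i m hm => by
      rw [← hc i m hm]
      refine Finset.sum_congr rfl fun k _ => ?_
      by_cases hk : k ∈ J
      · simp [hc', hk]
      · rw [← hEJ] at hk
        simp [eq_zero_of_notMem_errorSupport hk]
    have hc'j : c' j ≠ 0 := by simpa [hc', hj] using hcj
    have hcard : (Finset.univ.erase (0 : F)).card = Fintype.card F - 1 := by
      rw [Finset.card_erase_of_mem (Finset.mem_univ _), Finset.card_univ]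
    rw [← hcard]
    refine Finset.card_le_card_of_injOn (fun x => x • c') ?_ ?_
    · intro x hx
      have hx0 : x ≠ 0 := by simpa using hx
      refine Finset.mem_coe.2 ((Finset.mem_bipartiteAbove _).2
        ⟨Finset.mem_erase.2 ⟨fun h => ?_, (hmemC _).2 fun k hk => ?_⟩, hc'a.smul x⟩)
      · exact mul_ne_zero hx0 hc'j (congrFun h j)
      · simp [hc', hk]
    · intro x _ y _ hxy
      exact mul_right_cancel₀ hc'j (congrFun hxy j)
  have hQ : 1 ≤ Fintype.card F ^ ℓ := Nat.one_le_pow _ _ Fintype.card_pos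
  calc bad.card * ((Fintype.card F - 1) * (Fintype.card F ^ ℓ) ^ δ)
      = (∑ E ∈ bad, (Fintype.card F - 1)) * (Fintype.card F ^ ℓ) ^ δ := by
        rw [Finset.sum_const, smul_eq_mul, mul_assoc]
    _ ≤ (∑ E ∈ bad, (Finset.bipartiteAbove (IsAnnihilator a δ) (Cs.erase 0) E).card) *
          (Fintype.card F ^ ℓ) ^ δ := Nat.mul_le_mul_right _ (Finset.sum_le_sum hlow)
    _ = ∑ c ∈ Cs.erase 0, (Finset.bipartiteBelow (IsAnnihilator a δ) bad c).card *
          (Fintype.card F ^ ℓ) ^ δ := by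
        rw [Finset.sum_card_bipartiteAbove_eq_sum_card_bipartiteBelow, Finset.sum_mul]
    _ ≤ ∑ c ∈ Cs.erase 0, ∏ j, (if j ∈ J then
          (if c j = 0 then Fintype.card F ^ ℓ - 1 else Fintype.card F ^ ℓ) else 1) := by
        refine Finset.sum_le_sum fun c hc => ?_
        obtain ⟨hc0, hcC⟩ := Finset.mem_erase.1 hc
        refine le_trans (Nat.mul_le_mul_right _ (Finset.card_le_card fun E hE => ?_))
          (card_annihilated_mul_le ha J hc0 ((hmemC c).1 hcC))
        obtain ⟨hE1, hE2⟩ := (Finset.mem_bipartiteBelow _).1 hE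
        exact Finset.mem_filter.2 ⟨Finset.mem_univ _, (Finset.mem_filter.1 hE1).2.1, hE2⟩
    _ ≤ ∑ c ∈ Cs, ∏ j, (if j ∈ J then
          (if c j = 0 then Fintype.card F ^ ℓ - 1 else Fintype.card F ^ ℓ) else 1) :=
        Finset.sum_le_sum_of_subset (Finset.erase_subset _ _)
    _ = _ := sum_prod_ite_eq J hQ

open Classical in
theorem card_filter_errorSupport_eq {ℓ : ℕ} (J : Finset (Fin n)) :
    (Finset.univ.filter fun E : Matrix (Fin ℓ) (Fin n) F => errorSupport E = J).card =
      (Fintype.card F ^ ℓ - 1) ^ J.card := by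
  set B : Fin n → Finset (Fin ℓ → F) := fun j =>
    if j ∈ J then Finset.univ.erase 0 else {0} with hB
  have hBcard : (Fintype.piFinset B).card = (Fintype.card F ^ ℓ - 1) ^ J.card := by
    rw [Fintype.card_piFinset]
    simp only [hB, apply_ite Finset.card, Finset.card_singleton]
    rw [Finset.prod_ite_mem, Finset.univ_inter, Finset.prod_const]
    simp
  rw [← hBcard]
  refine Finset.card_equiv (Matrix.transposeAddEquiv (Fin ℓ) (Fin n) F).toEquiv fun E => ?_
  rw [Finset.mem_filter_univ, Fintype.mem_piFinset, Finset.ext_iff]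
  refine forall_congr' fun j => ?_
  rw [mem_errorSupport]
  have : (∃ i, E i j ≠ 0) ↔ (Matrix.transposeAddEquiv (Fin ℓ) (Fin n) F).toEquiv E j ≠ 0 := by
    rw [Function.ne_iff]; rfl
  rw [this]
  have h (x : Fin ℓ → F) : (x ≠ 0 ↔ j ∈ J) ↔ x ∈ B j := by
    by_cases hj : j ∈ J <;> simp [hB, hj]
  exact h _

open Classical in
/-- The number of error matrices of weight `t` that have a non-trivial annihilator. -/
theorem card_errorsOfWeight_exists_annihilator_mul_le {ℓ δ : ℕ} {a : Fin n → F}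
    (ha : Function.Injective a) (t : ℕ) :
    ((errorsOfWeight F ℓ n t).filter fun E =>
        ∃ c, IsAnnihilator a δ E c ∧ ∃ j ∈ errorSupport E, c j ≠ 0).card *
        ((Fintype.card F - 1) * (Fintype.card F ^ ℓ) ^ δ * (Fintype.card F ^ ℓ - 1) ^ t) ≤
      (Fintype.card F * Fintype.card F ^ ℓ - 1) ^ t * (errorsOfWeight F ℓ n t).card := by
  have hmaps : ∀ E ∈ errorsOfWeight F ℓ n t,
      errorSupport E ∈ Finset.powersetCard t Finset.univ := fun E hE =>
    Finset.mem_powersetCard.2 ⟨Finset.subset_univ _, (Finset.mem_filter.1 hE).2⟩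
  rw [Finset.card_eq_sum_card_fiberwise (s := errorsOfWeight F ℓ n t) hmaps,
    Finset.card_eq_sum_card_fiberwise fun E hE => hmaps E (Finset.mem_filter.1 hE).1,
    Finset.sum_mul, Finset.mul_sum]
  refine Finset.sum_le_sum fun J hJ => ?_
  have hJt := (Finset.mem_powersetCard.1 hJ).2
  have h1 : (errorsOfWeight F ℓ n t).filter (fun E => errorSupport E = J) =
      Finset.univ.filter fun E => errorSupport E = J := by
    ext E
    simp only [errorsOfWeight, Finset.mem_filter, Finset.mem_univ, true_and, and_iff_right_iff_imp]
    rintro rfl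
    exact hJt
  rw [h1, card_filter_errorSupport_eq, hJt, ← mul_assoc]
  refine Nat.mul_le_mul_right _ ?_
  have h2 := card_exists_annihilator_mul_le (ℓ := ℓ) (δ := δ) ha J
  rw [hJt] at h2
  refine le_trans (Nat.mul_le_mul_right _ (Finset.card_le_card fun E hE => ?_)) h2
  obtain ⟨hE1, hE2⟩ := Finset.mem_filter.1 hE
  rw [← hE2]
  exact Finset.mem_filter.2 ⟨Finset.mem_univ _, rfl, (Finset.mem_filter.1 hE1).2⟩

end InterleavedLRC

namespace InterleavedLRC

theorem hammingDist_add_card_eq {α : Type*} [DecidableEq α] {n : ℕ} (x y : Fin n → α) :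
    hammingDist x y + (Finset.univ.filter fun j => x j = y j).card = n := by
  rw [hammingDist, add_comm, Finset.card_filter_add_card_filter_not, Finset.card_univ,
    Fintype.card_fin]

variable {F : Type*} [Field F] {n : ℕ}

/-! ### An error matrix without annihilators -/

theorem exists_errorSupport_card_eq_forall_isAnnihilator {ℓ δ t : ℕ} {a : Fin n → F}
    (ha : Function.Injective a) (htn : t ≤ n) (ht : t ≤ ℓ * δ) :
    ∃ E : Matrix (Fin ℓ) (Fin n) F, (errorSupport E).card = t ∧
      ∀ c, IsAnnihilator a δ E c → ∀ j ∈ errorSupport E, c j = 0 := by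
  classical
  set E : Matrix (Fin ℓ) (Fin n) F :=
    Matrix.of fun i j => if (j : ℕ) < t ∧ (j : ℕ) / δ = i then 1 else 0 with hE
  have hmem : ∀ j, j ∈ errorSupport E ↔ (j : ℕ) < t := fun j => by
    rw [mem_errorSupport]
    constructor
    · rintro ⟨i, hi⟩
      by_contra h
      exact hi (by simp [hE, h])
    · intro h
      exact ⟨⟨j / δ, Nat.div_lt_of_lt_mul (by rw [mul_comm]; omega)⟩, by simp [hE, h]⟩
  refine ⟨E, ?_, fun c hc j hj => ?_⟩
  · have : errorSupport E = (Finset.univ : Finset (Fin t)).map (Fin.castLEEmb htn) := by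
      ext j
      rw [hmem, Finset.mem_map]
      exact ⟨fun h => ⟨⟨j, h⟩, Finset.mem_univ _, rfl⟩, by rintro ⟨i, -, rfl⟩; exact i.2⟩
    rw [this, Finset.card_map, Finset.card_univ, Fintype.card_fin]
  · obtain ⟨i, hi⟩ := mem_errorSupport.1 hj
    have hδ : 0 < δ := by
      rcases Nat.eq_zero_or_pos δ with rfl | h
      · have := (hmem j).1 hj
        omega
      · exact h
    set W : Finset (Fin n) := Finset.univ.filter fun j => (j : ℕ) / δ = i with hW
    have hWcard : W.card ≤ δ := by
      have h2 : (Finset.Ico (i * δ : ℕ) (i * δ + δ)).card = δ := by simp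
      rw [← h2]
      refine Finset.card_le_card_of_injOn (fun j => (j : ℕ)) (fun j hj => ?_)
        Fin.val_injective.injOn
      have h3 : (j : ℕ) / δ = i := by simpa [hW] using hj
      have h4 := Nat.div_add_mod (j : ℕ) δ
      have h5 := Nat.mod_lt (j : ℕ) hδ
      rw [h3, mul_comm] at h4
      have h6 : i * δ ≤ (j : ℕ) ∧ (j : ℕ) < i * δ + δ := by omega
      simpa using h6
    refine (mul_eq_zero.1 (hc.mul_eq_zero ha hWcard (i := i) (fun k hk => ?_) j)).resolve_left hi
    have : (k : ℕ) / δ ≠ i := by simpa [hW] using hk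
    simp [hE, this]

/-! ### Tamo-Barg codes as subcodes of Reed-Solomon codes -/

/-- The largest degree of an encoding polynomial. -/
def maxDegree (k r s : ℕ) : ℕ := (k - 1) % r + (k - 1) / r * s

theorem degree_tamoBargPoly_le {k r s : ℕ} (hrs : r ≤ s) (hr : 1 ≤ r) {g : F[X]}
    (hg : g.natDegree = s) (u : Fin k → F) : (tamoBargPoly r g u).natDegree ≤ maxDegree k r s := by
  refine natDegree_sum_le_of_forall_le _ _ fun m _ => ?_
  refine (natDegree_C_mul_le _ _).trans (natDegree_mul_le.trans ?_)
  rw [natDegree_X_pow]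
  have hm : (m : ℕ) ≤ k - 1 := by omega
  have h1 : (g ^ ((m : ℕ) / r)).natDegree ≤ (m : ℕ) / r * s := by
    rw [← hg]; exact natDegree_pow_le
  refine (Nat.add_le_add_left h1 _).trans ?_
  rw [maxDegree]
  rcases (Nat.div_le_div_right hm : (m : ℕ) / r ≤ (k - 1) / r).eq_or_lt with h | h
  · have h2 := Nat.div_add_mod (m : ℕ) r
    have h3 := Nat.div_add_mod (k - 1) r
    rw [h] at h2 ⊢
    omega
  · have h2 : ((m : ℕ) / r + 1) * s ≤ (k - 1) / r * s := Nat.mul_le_mul_right s h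
    have h3 := Nat.mod_lt (m : ℕ) hr
    rw [add_mul, one_mul] at h2
    omega

theorem sum_range_mul_div_mod {R : Type*} [CommSemiring R] (f h : ℕ → R) {r : ℕ} (hr : 1 ≤ r)
    (p : ℕ) :
    ∑ m ∈ Finset.range (r * p), f (m / r) * h (m % r) =
      (∑ j ∈ Finset.range p, f j) * ∑ i ∈ Finset.range r, h i := by
  induction p with
  | zero => simp
  | succ p ih =>
    rw [mul_add, mul_one, Finset.sum_range_add, ih, Finset.sum_range_succ, add_mul]
    congr 1
    rw [Finset.mul_sum]
    refine Finset.sum_congr rfl fun i hi => ?_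
    have hi := Finset.mem_range.1 hi
    rw [Nat.mul_add_div hr, Nat.div_eq_of_lt hi, Nat.mul_add_mod, Nat.mod_eq_of_lt hi, add_zero]

/-- Products of a polynomial of degree `≤ (k - 1) / r` in `g` and one of degree `≤ (k - 1) % r` in
`x` are encoding polynomials. -/
theorem exists_tamoBargPoly_eq {k r : ℕ} (hk : 1 ≤ k) (hr : 1 ≤ r) (g : F[X]) {h w : F[X]}
    (hh : h.natDegree ≤ (k - 1) / r) (hw : w.natDegree ≤ (k - 1) % r) :
    ∃ u : Fin k → F, tamoBargPoly r g u = h.comp g * w := by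
  refine ⟨fun m => h.coeff (m / r) * w.coeff (m % r), ?_⟩
  have hdm := Nat.div_add_mod (k - 1) r
  have hmod := Nat.mod_lt (k - 1) hr
  have hkle : k ≤ r * ((k - 1) / r + 1) := by rw [mul_add]; omega
  have hcomp : h.comp g =
      ∑ j ∈ Finset.range ((k - 1) / r + 1), C (h.coeff j) * g ^ j := by
    rw [comp, eval₂_eq_sum_range' C (Nat.lt_succ_of_le hh)]
  have hwsum : w = ∑ i ∈ Finset.range r, C (w.coeff i) * X ^ i :=
    w.as_sum_range_C_mul_X_pow' (by omega)
  conv_rhs => rw [hcomp, hwsum]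
  rw [← sum_range_mul_div_mod (fun j => C (h.coeff j) * g ^ j)
    (fun i => C (w.coeff i) * X ^ i) hr, tamoBargPoly,
    Finset.sum_fin_eq_sum_range]
  rw [← Finset.sum_subset (Finset.range_subset_range.2 hkle)]
  · refine Finset.sum_congr rfl fun m hm => ?_
    rw [dif_pos (Finset.mem_range.1 hm), C_mul]
    ring
  · intro m hm hmk
    rw [Finset.mem_range] at hm hmk
    have h1 : m / r < (k - 1) / r + 1 := Nat.div_lt_of_lt_mul hm
    have h2 : (k - 1) / r ≤ m / r := Nat.div_le_div_right (by omega)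
    have h3 : m / r = (k - 1) / r := by omega
    have h4 := Nat.div_add_mod m r
    rw [h3] at h4
    rw [coeff_eq_zero_of_natDegree_lt (p := w) (by omega)]
    simp

/-- The Tamo-Barg code has a non-zero codeword with as many zeros as the degree bound allows. -/
theorem exists_tamoBargCode_zeros {k r ρ : ℕ} {a : Fin n → F} {g : F[X]}
    (hTB : IsTamoBarg n k r ρ a g) :
    maxDegree k r (r + ρ - 1) < n ∧ ∃ u : Fin k → F, tamoBargPoly r g u ≠ 0 ∧
      maxDegree k r (r + ρ - 1) ≤ (errorLocations a (tamoBargPoly r g u)).card := by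
  classical
  have hk := hTB.one_le_k
  have hr := hTB.one_le_r
  have hρ := hTB.two_le_rho
  set s := r + ρ - 1 with hs
  set V := Finset.univ.image fun j => g.eval (a j) with hV
  have hfib : ∀ v ∈ V, (Finset.univ.filter fun j => g.eval (a j) = v).card = s := by
    intro v hv
    obtain ⟨i, -, rfl⟩ := Finset.mem_image.1 hv
    refine Eq.trans ?_ (hTB.card_group i)
    rw [← Set.ncard_coe_finset]
    simp
  have hcount : ∀ V₀ ⊆ V, (Finset.univ.filter fun j => g.eval (a j) ∈ V₀).card = V₀.card * s := by
    intro V₀ hV₀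
    rw [Finset.card_eq_sum_card_fiberwise (f := fun j => g.eval (a j)) (t := V₀)
      (fun j hj => by simpa using hj), ← smul_eq_mul, ← Finset.sum_const]
    refine Finset.sum_congr rfl fun v hv => ?_
    rw [← hfib v (hV₀ hv), Finset.filter_filter]
    congr 1
    ext j
    simp only [Finset.mem_filter_univ, and_iff_right_iff_imp]
    rintro rfl
    exact hv
  have hn : V.card * s = n := by
    rw [← hcount V subset_rfl, Finset.filter_true_of_mem, Finset.card_univ, Fintype.card_fin]
    exact fun j _ => Finset.mem_image_of_mem _ (Finset.mem_univ j)
  have hkV : k ≤ r * V.card := by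
    have h1 := hTB.rate_le
    rw [← hn] at h1
    refine le_of_mul_le_mul_right (a := s) (h1.trans_eq ?_) (by omega)
    ring
  set p := (k - 1) / r with hp
  set b := (k - 1) % r with hb
  have hpV : p < V.card := Nat.div_lt_of_lt_mul (by omega)
  have hbr : b < r := Nat.mod_lt _ hr
  have hmaxeq : maxDegree k r s = b + p * s := rfl
  refine ⟨?_, ?_⟩
  · have : (p + 1) * s ≤ V.card * s := Nat.mul_le_mul_right s hpV
    rw [hn, add_mul, one_mul] at this
    omega
  obtain ⟨V₀, hV₀, hV₀c⟩ := Finset.exists_subset_card_eq hpV.le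
  obtain ⟨γ, hγ, hγ₀⟩ : ∃ γ ∈ V, γ ∉ V₀ := by
    by_contra! h
    have := Finset.card_le_card (show V ⊆ V₀ from h)
    omega
  obtain ⟨U, hU, hUc⟩ := Finset.exists_subset_card_eq
    (show b ≤ (Finset.univ.filter fun j => g.eval (a j) = γ).card by rw [hfib γ hγ]; omega)
  obtain ⟨u, hu⟩ := exists_tamoBargPoly_eq hk hr g (h := Lagrange.nodal V₀ id)
    (w := Lagrange.nodal U a) (by rw [Lagrange.natDegree_nodal, hV₀c])
    (by rw [Lagrange.natDegree_nodal, hUc])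
  refine ⟨u, ?_, ?_⟩
  · rw [hu]
    refine mul_ne_zero (fun h => ?_) Lagrange.nodal_ne_zero
    rcases comp_eq_zero_iff.1 h with h | h
    · exact Lagrange.nodal_ne_zero h
    · have := congrArg natDegree h.2
      rw [hTB.natDegree_eq, natDegree_C] at this
      omega
  · have hdisj : Disjoint U (Finset.univ.filter fun j => g.eval (a j) ∈ V₀) := by
      refine Finset.disjoint_left.2 fun j hj hj' => hγ₀ ?_
      rw [← (Finset.mem_filter.1 (hU hj)).2]
      exact (Finset.mem_filter.1 hj').2
    rw [hmaxeq, ← hUc, ← hV₀c, ← hcount V₀ hV₀, ← Finset.card_union_of_disjoint hdisj]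
    refine Finset.card_le_card fun j hj => mem_errorLocations.2 ?_
    rw [hu, eval_mul, eval_comp]
    rcases Finset.mem_union.1 hj with hj | hj
    · rw [Lagrange.eval_nodal_at_node hj, mul_zero]
    · have h0 := Lagrange.eval_nodal_at_node (v := id) (Finset.mem_filter.1 hj).2
      rw [id] at h0
      rw [h0, zero_mul]

theorem one_le_of_isMinDist {C : Submodule F (Fin n → F)} {d : ℕ} (h : IsMinDist C d) :
    1 ≤ d := by
  classical
  obtain ⟨⟨x, -, y, -, hxy, rfl⟩, -⟩ := h
  exact hammingDist_pos.2 hxy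

theorem IsTamoBarg.le_sub_maxDegree {k r ρ d : ℕ} {a : Fin n → F} {g : F[X]}
    (hTB : IsTamoBarg n k r ρ a g) (hd : IsMinDist (tamoBargCode k r a g) d) :
    d + maxDegree k r (r + ρ - 1) ≤ n := by
  classical
  obtain ⟨hlt, u, hu0, hu⟩ := exists_tamoBargCode_zeros hTB
  have hdeg := degree_tamoBargPoly_le (s := r + ρ - 1) (by have := hTB.two_le_rho; omega)
    hTB.one_le_r hTB.natDegree_eq u
  set x : Fin n → F := fun j => (tamoBargPoly r g u).eval (a j) with hx
  have hloc : (Finset.univ.filter fun j => x j = (0 : Fin n → F) j) =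
      errorLocations a (tamoBargPoly r g u) := by
    ext j
    simp [hx, mem_errorLocations]
  have hx0 : x ≠ 0 := by
    intro h
    have h1 : (Finset.univ.filter fun j => x j = (0 : Fin n → F) j).card = n := by simp [h]
    rw [hloc] at h1
    have := card_errorLocations_le hTB.injective hu0
    omega
  have hmin := hd.2 ⟨x, ⟨u, fun _ => rfl⟩, 0, Submodule.zero_mem _, hx0, rfl⟩
  have hsum := hammingDist_add_card_eq x 0
  rw [hloc] at hsum
  have hmin' : d ≤ hammingDist x 0 := by convert hmin
  omega

theorem tamoBargCode_le_rsCode {k r ρ d : ℕ} {a : Fin n → F} {g : F[X]}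
    (hTB : IsTamoBarg n k r ρ a g) (hd : IsMinDist (tamoBargCode k r a g) d) :
    tamoBargCode k r a g ≤ rsCode a (n + 1 - d) := by
  rintro c ⟨u, hu⟩
  refine mem_rsCode.2 ⟨_, ?_, hu⟩
  have hle := hTB.le_sub_maxDegree hd
  have hdeg := degree_tamoBargPoly_le (s := r + ρ - 1) (by have := hTB.two_le_rho; omega)
    hTB.one_le_r hTB.natDegree_eq u
  refine lt_of_le_of_lt degree_le_natDegree ?_
  exact_mod_cast (by omega : (tamoBargPoly r g u).natDegree < n + 1 - d)

/-- A subcode of minimum distance `d` shows that the Reed-Solomon code meets the Singleton bound. -/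
theorem isMinDist_rsCode {d : ℕ} {a : Fin n → F} (ha : Function.Injective a)
    {D : Submodule F (Fin n → F)} (hD : D ≤ rsCode a (n + 1 - d)) (hd : IsMinDist D d) :
    IsMinDist (rsCode a (n + 1 - d)) d := by
  classical
  obtain ⟨⟨x, hx, y, hy, hxy, hdist⟩, -⟩ := hd
  refine ⟨⟨x, hD hx, y, hD hy, hxy, hdist⟩, ?_⟩
  rintro w ⟨x, hx, y, hy, hxy, rfl⟩
  obtain ⟨f, hf, hfx⟩ := mem_rsCode.1 hx
  obtain ⟨f', hf', hfy⟩ := mem_rsCode.1 hy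
  have hne : f - f' ≠ 0 := fun h => hxy (funext fun j => by rw [hfx, hfy, sub_eq_zero.1 h])
  have hdeg := (natDegree_lt_iff_degree_lt hne).2
    (lt_of_le_of_lt (degree_sub_le f f') (max_lt hf hf'))
  have hcard := card_errorLocations_le ha hne
  have hloc : (Finset.univ.filter fun j => x j = y j) = errorLocations a (f - f') := by
    ext j
    simp [hfx, hfy, mem_errorLocations, sub_eq_zero]
  have hsum := hammingDist_add_card_eq x y
  rw [hloc] at hsum
  have : d ≤ hammingDist x y := by omega
  convert this

end InterleavedLRC

namespace InterleavedLRC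

variable {F : Type*} [Field F] [Fintype F] {n ℓ : ℕ}

/-! ### Outcome probabilities -/

theorem errorsOfWeight_nonempty (hℓ : 1 ≤ ℓ) {t : ℕ} (ht : t ≤ n) :
    (errorsOfWeight F ℓ n t).Nonempty := by
  classical
  have h := card_filter_errorSupport_eq (F := F) (ℓ := ℓ)
    ((Finset.univ : Finset (Fin t)).map (Fin.castLEEmb ht))
  have hq := Fintype.one_lt_card (α := F)
  have hQ := Nat.one_lt_pow (by omega : ℓ ≠ 0) hq
  have hpos : 0 < (Fintype.card F ^ ℓ - 1) ^
      ((Finset.univ : Finset (Fin t)).map (Fin.castLEEmb ht)).card :=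
    pow_pos (by omega) _
  rw [← h, Finset.card_pos] at hpos
  obtain ⟨E, hE⟩ := hpos
  refine ⟨E, Finset.mem_filter.2 ⟨Finset.mem_univ _, ?_⟩⟩
  rw [(Finset.mem_filter.1 hE).2]
  simp

theorem errorFraction_mono {t : ℕ} {p p' : Matrix (Fin ℓ) (Fin n) F → Prop}
    (h : ∀ E, (errorSupport E).card = t → p E → p' E) :
    errorFraction t p ≤ errorFraction t p' := by
  classical
  refine div_le_div_of_nonneg_right (Nat.cast_le.2 (Finset.card_le_card fun E hE => ?_))
    (Nat.cast_nonneg _)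
  obtain ⟨h1, h2⟩ := Finset.mem_filter.1 hE
  exact Finset.mem_filter.2 ⟨h1, h E (Finset.mem_filter.1 h1).2 h2⟩

theorem errorFraction_add {t : ℕ} {p p' : Matrix (Fin ℓ) (Fin n) F → Prop}
    (h : ∀ E, p E → ¬ p' E) :
    errorFraction t p + errorFraction t p' = errorFraction t fun E => p E ∨ p' E := by
  classical
  rw [errorFraction, errorFraction, errorFraction, ← add_div, ← Nat.cast_add,
    ← Finset.card_union_of_disjoint (Finset.disjoint_filter.2 fun E _ => h E), ← Finset.filter_or]
  congr!

theorem errorFraction_eq_one (hℓ : 1 ≤ ℓ) {t : ℕ} (ht : t ≤ n)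
    {p : Matrix (Fin ℓ) (Fin n) F → Prop} (h : ∀ E, (errorSupport E).card = t → p E) :
    errorFraction t p = 1 := by
  classical
  rw [errorFraction, Finset.filter_true_of_mem (s := errorsOfWeight F ℓ n t) fun E hE => h E (Finset.mem_filter.1 hE).2]
  exact div_self (Nat.cast_ne_zero.2 (errorsOfWeight_nonempty hℓ ht).card_pos.ne')

theorem errorFraction_pos {t : ℕ} {p : Matrix (Fin ℓ) (Fin n) F → Prop}
    {E : Matrix (Fin ℓ) (Fin n) F} (hE : (errorSupport E).card = t) (h : p E) :
    0 < errorFraction t p := by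
  classical
  have h1 : E ∈ errorsOfWeight F ℓ n t := Finset.mem_filter.2 ⟨Finset.mem_univ _, hE⟩
  exact div_pos (Nat.cast_pos.2 (Finset.card_pos.2 ⟨E, Finset.mem_filter.2 ⟨h1, h⟩⟩))
    (Nat.cast_pos.2 (Finset.card_pos.2 ⟨E, h1⟩))

/-- For a decoder that only returns codewords of `D`, the probabilities of the three outcomes sum
to one. -/
theorem failureProb_add_miscorrectionProb_add_successProb (hℓ : 1 ≤ ℓ) {t : ℕ} (ht : t ≤ n)
    {D : Set (Matrix (Fin ℓ) (Fin n) F)}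
    {dec : Matrix (Fin ℓ) (Fin n) F → Option (Matrix (Fin ℓ) (Fin n) F)}
    (hdec : ∀ R Z, dec R = some Z → Z ∈ D) (Y : Matrix (Fin ℓ) (Fin n) F) :
    failureProb dec Y t + miscorrectionProb D dec Y t + successProb dec Y t = 1 := by
  rw [failureProb, miscorrectionProb, successProb, errorFraction_add, errorFraction_add,
    errorFraction_eq_one hℓ ht]
  · intro E _
    rcases h : dec (Y + E) with _ | Z
    · exact Or.inl (Or.inl rfl)
    · rcases eq_or_ne Z Y with rfl | hZ
      · exact Or.inr rfl
      · exact Or.inl (Or.inr ⟨Z, hdec _ _ h, hZ, rfl⟩)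
  · rintro E (h | ⟨Z, -, hZ, h⟩) h'
    · simp [h] at h'
    · exact hZ (Option.some.inj (h.symm.trans h'))
  · rintro E h ⟨Z, -, -, h'⟩
    simp [h] at h'

theorem subcodeDecoder_eq_some {M : Type*} {D : Set M} {dec : M → Option M} {R Z : M} :
    subcodeDecoder D dec R = some Z ↔ Z ∈ D ∧ dec R = some Z := by
  rw [subcodeDecoder]
  rcases dec R with _ | Z'
  · simp
  · by_cases h : Z' ∈ D
    · simp only [Option.bind_some, if_pos h, Option.some.injEq]
      exact ⟨by rintro rfl; exact ⟨h, rfl⟩, fun h => h.2⟩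
    · simp only [Option.bind_some, if_neg h, Option.some.injEq]
      refine ⟨fun h' => absurd h' (by simp), ?_⟩
      rintro ⟨h', rfl⟩
      exact absurd h' h

/-- The fraction of error matrices with a non-trivial annihilator, when `δ = d - 1 - t`. -/
theorem errorFraction_exists_annihilator_le (hℓ : 1 ≤ ℓ) {d t : ℕ} (hd : 1 ≤ d) (hdn : d ≤ n)
    {a : Fin n → F} (ha : Function.Injective a) (ht : (t : ℝ) ≤ tMax ℓ d) :
    errorFraction t (fun E : Matrix (Fin ℓ) (Fin n) F =>
        ∃ c, IsAnnihilator a (d - 1 - t) E c ∧ ∃ j ∈ errorSupport E, c j ≠ 0) ≤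
      (((Fintype.card F : ℝ) ^ ℓ - 1 / (Fintype.card F : ℝ)) /
          ((Fintype.card F : ℝ) ^ ℓ - 1)) ^ t *
        ((Fintype.card F : ℝ) ^ (-(((ℓ : ℝ) + 1) * (tMax ℓ d - t))) /
          ((Fintype.card F : ℝ) - 1)) := by
  classical
  have htd : t ≤ d - 1 := le_of_mul_le ((le_tMax_iff hd).1 ht)
  have hcount := card_errorsOfWeight_exists_annihilator_mul_le (ℓ := ℓ) (δ := d - 1 - t) ha t
  have hall := (errorsOfWeight_nonempty (F := F) hℓ (by omega : t ≤ n)).card_pos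
  have hq := Fintype.one_lt_card (α := F)
  rw [errorFraction]
  set q := Fintype.card F with hqdef
  set A := (errorsOfWeight F ℓ n t).card
  set δ := d - 1 - t with hδ
  have hQ : 1 < q ^ ℓ := Nat.one_lt_pow (by omega) hq
  have hqQ : 1 ≤ q * q ^ ℓ := Nat.mul_pos (by omega) (by omega)
  have hq0 : (0 : ℝ) < q := by exact_mod_cast (by omega : 0 < q)
  have hq1 : (0 : ℝ) < q - 1 := by rw [sub_pos]; exact_mod_cast hq
  have hQ1 : (0 : ℝ) < (q : ℝ) ^ ℓ - 1 := by rw [sub_pos]; exact_mod_cast hQ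
  have hexp : (q : ℝ) ^ (-(((ℓ : ℝ) + 1) * (tMax ℓ d - t))) = (q : ℝ) ^ t / ((q : ℝ) ^ ℓ) ^ δ := by
    have hdR : (d : ℝ) - 1 = δ + t := by
      rw [sub_eq_iff_eq_add]
      exact_mod_cast (by omega : d = δ + t + 1)
    have : -(((ℓ : ℝ) + 1) * (tMax ℓ d - t)) = (t : ℝ) - (ℓ * δ : ℕ) := by
      have h0 : (ℓ : ℝ) + 1 ≠ 0 := by positivity
      rw [tMax, hdR, mul_sub, ← mul_assoc, mul_div_cancel₀ _ h0]
      push_cast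
      ring
    rw [this, Real.rpow_sub hq0, Real.rpow_natCast, Real.rpow_natCast, pow_mul]
  have hbase : (q : ℝ) ^ ℓ - 1 / q = (q * (q : ℝ) ^ ℓ - 1) / q := by
    field_simp
  rw [hexp, hbase]
  have hR := (Nat.cast_le (α := ℝ)).2 hcount
  push_cast [Nat.cast_sub hqQ, Nat.cast_sub hq.le, Nat.cast_sub hQ.le] at hR
  rw [div_le_iff₀ (Nat.cast_pos.2 hall)]
  have hden : (0 : ℝ) < (q - 1) * ((q : ℝ) ^ ℓ) ^ δ * ((q : ℝ) ^ ℓ - 1) ^ t := by positivity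
  rw [← le_div_iff₀ hden] at hR
  refine le_trans (le_of_eq (by congr!)) (hR.trans_eq ?_)
  rw [div_pow, div_pow]
  field_simp

end InterleavedLRC

open InterleavedLRC
theorem mainTheorem7 {F : Type*} [Field F] [Fintype F] {n k r ρ ℓ d : ℕ} (hℓ : 1 ≤ ℓ)
    (a : Fin n → F) (g : F[X]) (hTB : IsTamoBarg n k r ρ a g)
    (hd : IsMinDist (tamoBargCode k r a g) d) (syn : RegisterSynthesis F ℓ (d - 1)) :
    -- the supercode: a Reed-Solomon code of the same minimum distance
    tamoBargCode k r a g ≤ rsCode a (n + 1 - d) ∧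
    IsMinDist (rsCode a (n + 1 - d)) d ∧
    -- transmitted codewords `Y` of the interleaved Tamo-Barg code, `Y₀` of the interleaved supercode
    ∀ t : ℕ, (t : ℝ) ≤ tMax ℓ d →
      ∀ Y ∈ interleaved ℓ (tamoBargCode k r a g),
      ∀ Y₀ ∈ interleaved ℓ (rsCode a (n + 1 - d)),
        -- the success probability for the interleaved Tamo-Barg code
        successProb (tamoBargDecoder ℓ k r a g d syn) Y t =
          1 - failureProb (collaborativeDecoder a d syn) Y₀ t
            - miscorrectionProb (interleaved ℓ (rsCode a (n + 1 - d)))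
                (collaborativeDecoder a d syn) Y₀ t ∧
        -- miscorrections outside the subcode become failures
        failureProb (tamoBargDecoder ℓ k r a g d syn) Y t
            + miscorrectionProb (interleaved ℓ (tamoBargCode k r a g))
                (tamoBargDecoder ℓ k r a g d syn) Y t =
          failureProb (collaborativeDecoder a d syn) Y₀ t
            + miscorrectionProb (interleaved ℓ (rsCode a (n + 1 - d)))
                (collaborativeDecoder a d syn) Y₀ t ∧
        miscorrectionProb (interleaved ℓ (tamoBargCode k r a g))
            (tamoBargDecoder ℓ k r a g d syn) Y t ≤
          miscorrectionProb (interleaved ℓ (rsCode a (n + 1 - d)))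
            (collaborativeDecoder a d syn) Y₀ t ∧
        -- the bound on the probability of an unsuccessful decoding
        failureProb (collaborativeDecoder a d syn) Y₀ t
            + miscorrectionProb (interleaved ℓ (rsCode a (n + 1 - d)))
                (collaborativeDecoder a d syn) Y₀ t ≤
          (((Fintype.card F : ℝ) ^ ℓ - 1 / (Fintype.card F : ℝ)) /
              ((Fintype.card F : ℝ) ^ ℓ - 1)) ^ t *
            ((Fintype.card F : ℝ) ^ (-(((ℓ : ℝ) + 1) * (tMax ℓ d - t))) /
              ((Fintype.card F : ℝ) - 1)) ∧
        0 < successProb (tamoBargDecoder ℓ k r a g d syn) Y t ∧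
        (2 * t < d → successProb (tamoBargDecoder ℓ k r a g d syn) Y t = 1) := by
  have ha := hTB.injective
  have hd1 := one_le_of_isMinDist hd
  have hdn : d ≤ n := by have := hTB.le_sub_maxDegree hd; omega
  have hsub := tamoBargCode_le_rsCode hTB hd
  refine ⟨hsub, isMinDist_rsCode ha hsub hd, fun t ht Y hY Y₀ hY₀ => ?_⟩
  have htmul := (le_tMax_iff hd1).1 ht
  have htd : t ≤ d - 1 := le_of_mul_le htmul
  have htn : t ≤ n := by omega
  have hYrs : Y ∈ interleaved ℓ (rsCode a (n + 1 - d)) := fun i => hsub (hY i)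
  -- the outcome of the decoders for a received matrix, in terms of the error matrix alone
  have hrs : ∀ Y ∈ interleaved ℓ (rsCode a (n + 1 - d)), ∀ E Z,
      collaborativeDecoder a d syn (Y + E) = some Z ↔
        collaborativeDecoder a d syn E = some (Z - Y) := by
    intro Y hY E Z
    rw [collaborativeDecoder_add ha hd1 hdn syn hY, Option.map_eq_some_iff]
    constructor
    · rintro ⟨Z', h, rfl⟩
      rw [h, add_sub_cancel_left]
    · exact fun h => ⟨_, h, add_sub_cancel _ _⟩
  have htb : ∀ E Z, tamoBargDecoder ℓ k r a g d syn (Y + E) = some Z ↔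
      Z ∈ interleaved ℓ (tamoBargCode k r a g) ∧
        collaborativeDecoder a d syn E = some (Z - Y) := fun E Z => by
    rw [tamoBargDecoder, subcodeDecoder_eq_some, hrs Y hYrs]
  have hsucc_tb : successProb (tamoBargDecoder ℓ k r a g d syn) Y t =
      errorFraction t fun E => collaborativeDecoder a d syn E = some 0 := by
    simp only [successProb, htb, sub_self, hY, true_and]
  have hsucc_rs : successProb (collaborativeDecoder a d syn) Y₀ t =
      errorFraction t fun E => collaborativeDecoder a d syn E = some 0 := by
    simp only [successProb, hrs Y₀ hY₀, sub_self]
  have hsum_tb := failureProb_add_miscorrectionProb_add_successProb hℓ htn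
    (D := interleaved ℓ (tamoBargCode k r a g)) (dec := tamoBargDecoder ℓ k r a g d syn)
    (fun R Z h => (subcodeDecoder_eq_some.1 h).1) Y
  have hsum_rs := failureProb_add_miscorrectionProb_add_successProb hℓ htn
    (D := interleaved ℓ (rsCode a (n + 1 - d))) (dec := collaborativeDecoder a d syn)
    (fun R Z h => mem_of_collaborativeDecoder_eq_some ha hd1 hdn h) Y₀
  rw [hsucc_tb] at hsum_tb
  rw [hsucc_rs] at hsum_rs
  refine ⟨by rw [hsucc_tb]; linarith, by linarith, ?_, ?_, ?_, fun h2 => ?_⟩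
  · refine errorFraction_mono fun E _ => ?_
    rintro ⟨Z, hZ, hZY, h⟩
    have h0 := ((htb E Z).1 h).2
    refine ⟨Y₀ + (Z - Y), fun i => ?_, by simpa [sub_eq_zero] using hZY,
      (hrs Y₀ hY₀ _ _).2 (by rw [add_sub_cancel_left]; exact h0)⟩
    exact Submodule.add_mem _ (hY₀ i) (Submodule.sub_mem _ (hsub (hZ i)) (hYrs i))
  · refine le_trans ?_ (errorFraction_exists_annihilator_le hℓ hd1 hdn ha ht)
    have hone := errorFraction_eq_one (F := F) hℓ htn
      (p := fun E => collaborativeDecoder a d syn E = some 0 ∨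
        ¬ collaborativeDecoder a d syn E = some 0) fun E _ => em _
    rw [← errorFraction_add fun E h h' => h' h] at hone
    refine le_trans (by linarith : _ ≤ errorFraction t fun E =>
      ¬ collaborativeDecoder a d syn E = some 0) (errorFraction_mono fun E hE h => ?_)
    by_contra! hcon
    exact h (collaborativeDecoder_eq_some_zero ha hd1 syn hE ht hcon)
  · have hle : t ≤ ℓ * (d - 1 - t) := by
      rw [Nat.mul_sub]
      rw [add_mul, one_mul] at htmul
      omega
    obtain ⟨E, hE, hann⟩ := exists_errorSupport_card_eq_forall_isAnnihilator ha htn hle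
    rw [hsucc_tb]
    exact errorFraction_pos hE (collaborativeDecoder_eq_some_zero ha hd1 syn hE ht hann)
  · rw [hsucc_tb]
    refine errorFraction_eq_one hℓ htn fun E hE =>
      collaborativeDecoder_eq_some_zero ha hd1 syn hE ht fun c hc j hj =>
        hc.eq_zero_of_card_le ha (by omega) hj
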